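/- For an integer $n\ge 0$ and $x,y\in\mathbb R$ put $\|(x,y)\|_{1/n}=(|x|^{1/n}+|y|^{1/n})^n$ if $n\neq 0$ and $\|(x,y)\|_{1/n}=\max\{|x|,|y|\}$ if $n=0$. A locally compact group $G$ with left Haar measure $\mu$ and right Haar measure $\nu$ is said to satisfy the Brunn--Minkowski inequality with exponent $n$, abbreviated $\mathrm{BM}(n)$, if $$\left\|\left(\frac{\nu(X)}{\nu(XY)},\frac{\mu(Y)}{\mu(XY)}\right)\right\|_{1/n}\le 1$$ for all nonempty compact sets $X,Y\subseteq G$, where $XY=\{xy: x\in X,\ y\in Y\}$ and $0/0$ is read as $0$. (This does not depend on the choice of $\mu$ and $\nu$.) Lie groups are real, finite-dimensional, Hausdorff and second countable, and subgroups carry the subspace topology. **Proposition.** Let $n\ge 0$ be an integer and let $G$ be a connected unimodular Lie group. Let $H$ be a connected closed subgroup of $G$ satisfying $\mathrm{BM}(n)$, and let $K$ be a connected closed unimodular subgroup of $G$ such that $G=KH$ and $K\cap H$ is compact. Then $G$ satisfies $\mathrm{BM}(n)$. -/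

import Mathlib

open MeasureTheory
open scoped Pointwise Manifold ContDiff

/-- A left Haar measure on the Borel sets of `G`: a nonzero regular measure that is finite on
compact sets and invariant under left translations (in Mathlib, `IsHaarMeasure` expresses
left-invariance, finiteness on compact sets and positivity on nonempty open sets). -/
structure IsLeftHaar {G : Type*} [Group G] [TopologicalSpace G] [MeasurableSpace G] [BorelSpace G]
    (μ : Measure G) : Prop where
  isHaar : μ.IsHaarMeasure
  regular : μ.Regular

/-- A right Haar measure on the Borel sets of `G`: a nonzero regular measure that is finite on
compact sets and invariant under right translations. -/
structure IsRightHaar {G : Type*} [Group G] [TopologicalSpace G] [MeasurableSpace G] [BorelSpace G]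
    (ν : Measure G) : Prop where
  rightInvariant : ν.IsMulRightInvariant
  finiteOnCompacts : IsFiniteMeasureOnCompacts ν
  openPos : ν.IsOpenPosMeasure
  regular : ν.Regular

/-- A locally compact group is unimodular if its modular function is identically `1`, that is, if
`μ (A x) = μ A` for every left Haar measure `μ`, every `x` and every measurable set `A`. -/
def IsUnimodular (G : Type*) [Group G] [TopologicalSpace G] [MeasurableSpace G] [BorelSpace G] :
    Prop :=
  ∀ μ : Measure G, IsLeftHaar μ → μ.IsMulRightInvariant

/-- `‖(x, y)‖_{1/n}`, which is `(|x|^{1/n} + |y|^{1/n})^n` for `n ≠ 0` and `max |x| |y|` for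
`n = 0`. -/
noncomputable def bmNorm (n : ℕ) (x y : ℝ) : ℝ :=
  if n = 0 then max |x| |y| else (|x| ^ (1 / (n : ℝ)) + |y| ^ (1 / (n : ℝ))) ^ n

/-- The Brunn--Minkowski inequality with exponent `n` on a locally compact group `G`: for all left
Haar measures `μ`, right Haar measures `ν` and nonempty compact sets `X, Y`, the pair of ratios
`ν X / ν (X Y)` and `μ Y / μ (X Y)` has `1/n`-norm at most `1`. For nonempty compact sets
`ν X ≤ ν (X Y)` and `μ Y ≤ μ (X Y)`, so a ratio whose denominator vanishes is `0 / 0`, and is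
read as `0`. -/
def SatisfiesBM (n : ℕ) (G : Type*) [Group G] [TopologicalSpace G] [MeasurableSpace G]
    [BorelSpace G] : Prop :=
  ∀ μ ν : Measure G, IsLeftHaar μ → IsRightHaar ν →
    ∀ X Y : Set G, IsCompact X → IsCompact Y → X.Nonempty → Y.Nonempty →
      bmNorm n (ν.real X / ν.real (X * Y)) (μ.real Y / μ.real (X * Y)) ≤ 1

/-! Haar measure on `G = KH` disintegrates over `K`: `ν B` is proportional to the integral over `k`
of the right Haar measure of `{h | k h ∈ B}`, and `μ B` to that of the left Haar measure of `{h | h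
k⁻¹ ∈ B}` (`exists_measure_eq_mul_prod_setOf_mul_mem`). Let `X_k`, `Y_k'` be these sections of `X`
and `Y`. Since `k X_k Y_k' k'⁻¹ ⊆ XY`, integrating the right measure of `X_k Y_k'` over `k` costs at
most `ν (XY)` for each `k'`, and integrating the left measure over `k'` at most `μ (XY)` for each
`k`. `BM(n)` in `H` applies to every pair `(k, k')`. These inequalities are averaged over `K × K` by
`rpow_add_rpow_le_one_of_forall`: convexity of `u ↦ u ^ (-1/n)` replaces each power by its tangent
line at the global ratio, leaving terms that Fubini can integrate. -/

section

open scoped ENNReal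

/-! ### Haar measure on `G = KH` -/

/-- A left translation rescales a right Haar measure by a positive finite factor. -/
lemma exists_lintegral_mul_left_eq_mul_of_inv {L : Type*} [Group L] [TopologicalSpace L]
    [IsTopologicalGroup L] [LocallyCompactSpace L] [SecondCountableTopology L]
    [MeasurableSpace L] [BorelSpace L] (μ : Measure L) [μ.IsHaarMeasure] (g : L) :
    ∃ c : ℝ≥0∞, c ≠ 0 ∧ c ≠ ⊤ ∧ ∀ f : L → ℝ≥0∞, Measurable f →
      ∫⁻ x, f (g * x) ∂μ.inv = c * ∫⁻ x, f x ∂μ.inv := by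
  refine ⟨(Measure.haarScalarFactor (μ.map (· * g⁻¹)) μ : ℝ≥0∞), ?_, ENNReal.coe_ne_top, ?_⟩
  · exact_mod_cast (Measure.haarScalarFactor_pos_of_isHaarMeasure _ _).ne'
  · intro f hf
    -- Right translation preserves left-invariance, so uniqueness of Haar measure supplies the
    -- factor.
    have h := Measure.isMulLeftInvariant_eq_smul (μ.map (· * g⁻¹)) μ
    have hinv : ∀ u : L → ℝ≥0∞, Measurable u → ∫⁻ x, u x ∂μ.inv = ∫⁻ x, u x⁻¹ ∂μ := fun u hu ↦ by
      rw [Measure.inv, lintegral_map hu measurable_inv]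
    rw [hinv _ (by fun_prop), hinv _ hf]
    have h2 : ∫⁻ x, f x⁻¹ ∂(μ.map (· * g⁻¹)) = ∫⁻ x, f (g * x⁻¹) ∂μ := by
      rw [lintegral_map (by fun_prop) (by fun_prop)]
      simp
    rw [← h2]
    conv_lhs => rw [h]
    rw [lintegral_smul_measure]
    rfl

instance Subgroup.instSecondCountableTopology {G : Type*} [Group G] [TopologicalSpace G]
    [SecondCountableTopology G] (H : Subgroup G) : SecondCountableTopology H :=
  TopologicalSpace.Subtype.secondCountableTopology (H : Set G)

/-- The preimage in `K × H` of a product of compact sets has finite measure. -/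
lemma measure_setOf_mul_mem_mul_lt_top {G : Type*} [Group G] [TopologicalSpace G]
    [IsTopologicalGroup G] [MeasurableSpace G] {K H : Subgroup G}
    (hK : IsClosed (K : Set G)) (hH : IsClosed (H : Set G))
    (hc : IsCompact ((K : Set G) ∩ (H : Set G)))
    (m : Measure (K × H)) [IsFiniteMeasureOnCompacts m]
    {C : Set K} {D : Set H} (hC : IsCompact C) (hD : IsCompact D) :
    m {p | (p.1 : G) * p.2 ∈ ((↑) '' C : Set G) * ((↑) '' D : Set G)} < ⊤ := by
  have hMK : IsCompact ((↑) ⁻¹' ((K : Set G) ∩ (H : Set G)) : Set K) :=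
    hK.isClosedEmbedding_subtypeVal.isCompact_preimage hc
  have hMH : IsCompact ((↑) ⁻¹' ((K : Set G) ∩ (H : Set G)) : Set H) :=
    hH.isClosedEmbedding_subtypeVal.isCompact_preimage hc
  refine lt_of_le_of_lt (measure_mono ?_) ((hC.mul hMK).prod (hMH.mul hD)).measure_lt_top
  rintro ⟨k, h⟩ ⟨_, ⟨c, hcC, rfl⟩, _, ⟨d, hdD, rfl⟩, hcd⟩
  have hcd : (c : G) * d = k * h := hcd
  -- Two factorisations of one element differ by an element of the compact group `K ∩ H`.
  have e : (c : G)⁻¹ * k = d * (h : G)⁻¹ := by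
    rw [inv_mul_eq_iff_eq_mul, ← mul_assoc, hcd, mul_inv_cancel_right]
  have hm : (c : G)⁻¹ * k ∈ (K : Set G) ∩ (H : Set G) :=
    ⟨K.mul_mem (K.inv_mem c.2) k.2, e ▸ H.mul_mem d.2 (H.inv_mem h.2)⟩
  have hm' : (h : G) * (d : G)⁻¹ ∈ (K : Set G) ∩ (H : Set G) := by
    have := (K ⊓ H).inv_mem (x := (c : G)⁻¹ * k) hm
    rw [e] at this
    simpa using this
  refine ⟨⟨c, hcC, c⁻¹ * k, hm, by simp⟩, ⟨h * d⁻¹, hm', d, hdD, by simp⟩⟩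

section

variable {G : Type*} [Group G] [TopologicalSpace G] [IsTopologicalGroup G]
  [SecondCountableTopology G] [MeasurableSpace G] [BorelSpace G] {K H : Subgroup G}

lemma measure_setOf_mul_mul_mem (m : Measure (K × H)) {B : Set G} (hB : MeasurableSet B) (g : G) :
    m {p | (p.1 : G) * g * p.2 ∈ B} = ∫⁻ p, B.indicator 1 ((p.1 : G) * g * p.2) ∂m := by
  have hmeas : MeasurableSet {p : K × H | (p.1 : G) * g * p.2 ∈ B} :=
    hB.preimage (f := fun p : K × H ↦ (p.1 : G) * g * p.2) (by fun_prop)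
  rw [← lintegral_indicator_one hmeas]
  rfl

/-- Fubini for the two-sided action of `K × H` on `G`. -/
lemma lintegral_mul_measure_setOf_mul_mul_mem (hKH : (K : Set G) * (H : Set G) = Set.univ)
    (μK : Measure K) [SFinite μK] [μK.IsMulLeftInvariant]
    (νH : Measure H) [SFinite νH] [νH.IsMulRightInvariant]
    (lam : Measure G) [SFinite lam]
    (hl : ∀ k ∈ K, MeasurePreserving (k * ·) lam lam)
    (hr : ∀ h ∈ H, MeasurePreserving (· * h) lam lam)
    {F : G → ℝ≥0∞} (hF : Measurable F) {B : Set G} (hB : MeasurableSet B) :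
    ∫⁻ g, F g * (μK.prod νH) {p | (p.1 : G) * g * p.2 ∈ B} ∂lam =
      lam B * ∫⁻ p, F ((p.1 : G)⁻¹ * (p.2 : G)⁻¹) ∂(μK.prod νH) := by
  have hI : Measurable (B.indicator (1 : G → ℝ≥0∞)) := measurable_one.indicator hB
  -- Writing `y = k₀ h₀`, left translation in `K` absorbs `k₀` and right translation in `H` absorbs
  -- `h₀`.
  have hconst : ∀ y : G, ∫⁻ p : K × H, F ((p.1 : G)⁻¹ * y * (p.2 : G)⁻¹) ∂(μK.prod νH) =
      ∫⁻ p : K × H, F ((p.1 : G)⁻¹ * (p.2 : G)⁻¹) ∂(μK.prod νH) := by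
    intro y
    obtain ⟨k₀, hk₀, h₀, hh₀, rfl⟩ : y ∈ (K : Set G) * (H : Set G) := hKH ▸ Set.mem_univ y
    rw [lintegral_prod _ (by fun_prop), lintegral_prod _ (by fun_prop),
      ← lintegral_mul_left_eq_self _ (⟨k₀, hk₀⟩ : K)]
    refine lintegral_congr fun k ↦ ?_
    rw [← lintegral_mul_right_eq_self _ (⟨h₀, hh₀⟩ : H)]
    refine lintegral_congr fun h ↦ congrArg F ?_
    simp only [Subgroup.coe_mul]
    group
  calc ∫⁻ g, F g * (μK.prod νH) {p | (p.1 : G) * g * p.2 ∈ B} ∂lam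
      = ∫⁻ g, ∫⁻ p : K × H, F g * B.indicator 1 ((p.1 : G) * g * p.2) ∂(μK.prod νH) ∂lam := by
        refine lintegral_congr fun g ↦ ?_
        rw [measure_setOf_mul_mul_mem _ hB, lintegral_const_mul _ (by fun_prop)]
    _ = ∫⁻ p : K × H, ∫⁻ g, F g * B.indicator 1 ((p.1 : G) * g * p.2) ∂lam ∂(μK.prod νH) :=
        lintegral_lintegral_swap (by unfold Function.uncurry; fun_prop)
    _ = ∫⁻ p : K × H, ∫⁻ g, F ((p.1 : G)⁻¹ * g * (p.2 : G)⁻¹) * B.indicator 1 g ∂lam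
          ∂(μK.prod νH) := by
        refine lintegral_congr fun p ↦ ?_
        rw [← ((hl p.1 p.1.2).comp (hr p.2 p.2.2)).lintegral_comp
          (f := fun g ↦ F ((p.1 : G)⁻¹ * g * (p.2 : G)⁻¹) * B.indicator 1 g) (by fun_prop)]
        refine lintegral_congr fun g ↦ ?_
        simp [mul_assoc]
    _ = ∫⁻ g, ∫⁻ p : K × H, F ((p.1 : G)⁻¹ * g * (p.2 : G)⁻¹) * B.indicator 1 g ∂(μK.prod νH)
          ∂lam := lintegral_lintegral_swap (by unfold Function.uncurry; fun_prop)
    _ = ∫⁻ g, (∫⁻ p : K × H, F ((p.1 : G)⁻¹ * (p.2 : G)⁻¹) ∂(μK.prod νH)) * B.indicator 1 g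
          ∂lam := by
        refine lintegral_congr fun g ↦ ?_
        rw [lintegral_mul_const _ (by fun_prop), hconst]
    _ = _ := by
        rw [lintegral_const_mul _ hI, lintegral_indicator_one hB, mul_comm]

/-- With `g = k₀ h₀`, right invariance on `K` removes `k₀`, while `h₀` acts on the left of a right
Haar measure and costs a modular factor. This factor depends on `g` but not on `B`. -/
lemma exists_measure_setOf_mul_mul_mem_eq (hKH : (K : Set G) * (H : Set G) = Set.univ)
    [LocallyCompactSpace H] (μK : Measure K) [SFinite μK] [μK.IsMulRightInvariant]
    (μH : Measure H) [μH.IsHaarMeasure] [SFinite μH] (g : G) :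
    ∃ c : ℝ≥0∞, c ≠ 0 ∧ c ≠ ⊤ ∧ ∀ B : Set G, MeasurableSet B →
      (μK.prod μH.inv) {p | (p.1 : G) * g * p.2 ∈ B} =
        c * (μK.prod μH.inv) {p | (p.1 : G) * p.2 ∈ B} := by
  obtain ⟨k₀, hk₀, h₀, hh₀, rfl⟩ : g ∈ (K : Set G) * (H : Set G) := hKH ▸ Set.mem_univ g
  obtain ⟨c, hc0, hct, hc⟩ := exists_lintegral_mul_left_eq_mul_of_inv μH ⟨h₀, hh₀⟩
  refine ⟨c, hc0, hct, fun B hB ↦ ?_⟩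
  have hI : Measurable (B.indicator (1 : G → ℝ≥0∞)) := measurable_one.indicator hB
  have h1 := measure_setOf_mul_mul_mem (μK.prod μH.inv) hB 1
  simp only [mul_one] at h1
  rw [measure_setOf_mul_mul_mem _ hB, h1, lintegral_prod _ (by fun_prop),
    lintegral_prod _ (by fun_prop), ← lintegral_const_mul _ (by fun_prop),
    ← lintegral_mul_right_eq_self (μ := μK) (fun k ↦ c * _) (⟨k₀, hk₀⟩ : K)]
  refine lintegral_congr fun k ↦ ?_
  rw [← hc (fun h ↦ B.indicator 1 (((k * ⟨k₀, hk₀⟩ : K) : G) * h)) (by fun_prop)]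
  refine lintegral_congr fun h ↦ ?_
  simp [mul_assoc]

/-- The product formula: a measure on `G = KH` that is invariant under left translations by `K` and
right translations by `H` is proportional to the image of the product of Haar measures. -/
lemma exists_measure_eq_mul_prod_setOf_mul_mem [T2Space G]
    [LocallyCompactSpace K] [LocallyCompactSpace H]
    (hK : IsClosed (K : Set G)) (hH : IsClosed (H : Set G))
    (hc : IsCompact ((K : Set G) ∩ (H : Set G)))
    (hKH : (K : Set G) * (H : Set G) = Set.univ)
    (μK : Measure K) [μK.IsHaarMeasure] [SFinite μK] [μK.IsMulRightInvariant]
    (μH : Measure H) [μH.IsHaarMeasure] [SFinite μH]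
    (lam : Measure G) [SFinite lam] [IsFiniteMeasureOnCompacts lam]
    (hl : ∀ k ∈ K, MeasurePreserving (k * ·) lam lam)
    (hr : ∀ h ∈ H, MeasurePreserving (· * h) lam lam) :
    ∃ C : ℝ≥0∞, ∀ B : Set G, MeasurableSet B →
      lam B = C * (μK.prod μH.inv) {p | (p.1 : G) * p.2 ∈ B} := by
  set P := μK.prod μH.inv with hP
  by_cases hlam : lam = 0
  · exact ⟨0, by simp [hlam]⟩
  -- A product of large compact sets serves as normalisation: compactness gives finiteness,
  -- exhaustion gives positivity.
  obtain ⟨B₀, hB₀, hlt, hltP, hpos, hposP⟩ : ∃ B₀ : Set G, MeasurableSet B₀ ∧ lam B₀ ≠ ⊤ ∧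
      P {p | (p.1 : G) * p.2 ∈ B₀} ≠ ⊤ ∧ lam B₀ ≠ 0 ∧ P {p | (p.1 : G) * p.2 ∈ B₀} ≠ 0 := by
    let S : ℕ → Set G := fun i ↦
      ((↑) '' compactCovering K i : Set G) * ((↑) '' compactCovering H i : Set G)
    have hmono : Monotone S := fun i j hij ↦ Set.mul_subset_mul
      (Set.image_mono (compactCovering_subset K hij)) (Set.image_mono (compactCovering_subset H hij))
    have hS : ∀ i, IsCompact (S i) := fun i ↦
      ((isCompact_compactCovering K i).image continuous_subtype_val).mul
        ((isCompact_compactCovering H i).image continuous_subtype_val)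
    have hU : ⋃ i, S i = Set.univ := by
      refine Set.eq_univ_of_forall fun g ↦ ?_
      obtain ⟨k, hk, h, hh, rfl⟩ : g ∈ (K : Set G) * (H : Set G) := hKH ▸ Set.mem_univ g
      obtain ⟨i, hi⟩ := exists_mem_compactCovering (⟨k, hk⟩ : K)
      obtain ⟨j, hj⟩ := exists_mem_compactCovering (⟨h, hh⟩ : H)
      exact Set.mem_iUnion.2 ⟨max i j, Set.mul_mem_mul
        ⟨_, compactCovering_subset K (le_max_left i j) hi, rfl⟩
        ⟨_, compactCovering_subset H (le_max_right i j) hj, rfl⟩⟩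
    obtain ⟨i, hi⟩ : ∃ i, lam (S i) ≠ 0 := by
      by_contra! h
      exact hlam (Measure.measure_univ_eq_zero.1 (hU ▸ measure_iUnion_null h))
    obtain ⟨j, hj⟩ : ∃ j, P {p | (p.1 : G) * p.2 ∈ S j} ≠ 0 := by
      by_contra! h
      have h' := measure_iUnion_null h
      change P (⋃ i, (fun p : K × H ↦ (p.1 : G) * p.2) ⁻¹' S i) = 0 at h'
      rw [← Set.preimage_iUnion, hU, Set.preimage_univ] at h'
      exact isOpen_univ.measure_ne_zero P Set.univ_nonempty h'
    refine ⟨S (max i j), (hS _).measurableSet, (hS _).measure_lt_top.ne,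
      (measure_setOf_mul_mem_mul_lt_top hK hH hc P (isCompact_compactCovering K _)
        (isCompact_compactCovering H _)).ne,
      fun h ↦ hi (measure_mono_null (hmono (le_max_left i j)) h),
      fun h ↦ hj (measure_mono_null (fun p hp ↦ hmono (le_max_right i j) hp) h)⟩
  set a := P {p | (p.1 : G) * p.2 ∈ B₀}
  let φ : G → ℝ≥0∞ := fun g ↦ P {p | (p.1 : G) * g * p.2 ∈ B₀}
  have hφ : Measurable φ := by
    have : MeasurableSet {q : G × (K × H) | (q.2.1 : G) * q.1 * q.2.2 ∈ B₀} :=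
      hB₀.preimage (f := fun q : G × (K × H) ↦ (q.2.1 : G) * q.1 * q.2.2) (by fun_prop)
    exact measurable_measure_prodMk_left this
  -- The weight `1 / φ` cancels the modular factor of `g`, so the Fubini integrand becomes constant
  -- on `B₀`.
  let F : G → ℝ≥0∞ := B₀.indicator fun g ↦ (φ g)⁻¹
  have hF : Measurable F := hφ.inv.indicator hB₀
  have key : ∀ B, MeasurableSet B → lam B₀ * (P {p | (p.1 : G) * p.2 ∈ B} / a) =
      lam B * ∫⁻ p, F ((p.1 : G)⁻¹ * (p.2 : G)⁻¹) ∂P := by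
    intro B hB
    rw [← lintegral_mul_measure_setOf_mul_mul_mem hKH μK μH.inv lam hl hr hF hB, ← hP,
      mul_comm, ← setLIntegral_const, ← lintegral_indicator hB₀]
    refine lintegral_congr fun g ↦ ?_
    by_cases hg : g ∈ B₀
    · obtain ⟨c, hc0, hct, hcB⟩ := exists_measure_setOf_mul_mul_mem_eq hKH μK μH g
      simp only [F, φ, Set.indicator_of_mem hg]
      rw [hcB _ hB, hcB _ hB₀, mul_comm _⁻¹, ← div_eq_mul_inv, ENNReal.mul_div_mul_left _ _ hc0 hct]
    · simp [F, hg]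
  -- Taking `B = B₀` shows that the remaining integral of `F` equals `1`.
  have h0 := key B₀ hB₀
  rw [ENNReal.div_self hposP hltP, mul_one] at h0
  have h1 : ∫⁻ p, F ((p.1 : G)⁻¹ * (p.2 : G)⁻¹) ∂P = 1 :=
    (ENNReal.mul_right_inj hpos hlt).1 (by rw [mul_one, ← h0])
  refine ⟨lam B₀ / a, fun B hB ↦ ?_⟩
  have := key B hB
  rw [h1, mul_one] at this
  rw [← this, div_eq_mul_inv, div_eq_mul_inv, mul_assoc, mul_comm a⁻¹]

end

/-! ### Averaging the inequality over a product -/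

/-- The tangent line inequality for `u ↦ u ^ (-r)`. -/
lemma Real.rpow_mul_one_add_le {r s x : ℝ} (hr : 0 ≤ r) (hs : 0 < s) (hx : 0 < x) :
    s ^ r * (1 + r) ≤ x ^ r + r * s ^ r * (s / x) := by
  have h : 1 + r ≤ (x / s) ^ r + r * (s / x) := by
    rw [Real.rpow_def_of_pos (by positivity)]
    have h1 := Real.add_one_le_exp (Real.log (x / s) * r)
    have h2 := Real.log_le_sub_one_of_pos (x := s / x) (by positivity)
    rw [← inv_div x s, Real.log_inv, inv_div x s] at h2
    nlinarith
  have h3 := mul_le_mul_of_nonneg_left h (Real.rpow_nonneg hs.le r)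
  rw [Real.div_rpow hx.le hs.le, mul_add (s ^ r) (x ^ r / s ^ r),
    mul_div_cancel₀ _ (Real.rpow_pos_of_pos hs r).ne'] at h3
  linarith

/-- Averaging a Brunn-Minkowski type inequality over a product space. -/
lemma rpow_add_rpow_le_one_of_forall {S T : Type*} [MeasurableSpace S] [MeasurableSpace T]
    (m₁ : Measure S) (m₂ : Measure T) [SFinite m₁] [SFinite m₂]
    {α : S → ℝ≥0∞} {β : T → ℝ≥0∞} {f g : S × T → ℝ≥0∞} (hα : Measurable α) (hβ : Measurable β)
    (hf : Measurable f) (hg : Measurable g)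
    (hα0 : ∫⁻ x, α x ∂m₁ ≠ 0) (hα1 : ∫⁻ x, α x ∂m₁ ≠ ⊤)
    (hβ0 : ∫⁻ y, β y ∂m₂ ≠ 0) (hβ1 : ∫⁻ y, β y ∂m₂ ≠ ⊤)
    {r s t : ℝ} (hr : 0 ≤ r) (hs : 0 < s) (ht : 0 < t)
    (hfs : ∀ y, ENNReal.ofReal s * ∫⁻ x, f (x, y) ∂m₁ ≤ ∫⁻ x, α x ∂m₁)
    (hgt : ∀ x, ENNReal.ofReal t * ∫⁻ y, g (x, y) ∂m₂ ≤ ∫⁻ y, β y ∂m₂)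
    (hαtop : ∀ x, α x ≠ ⊤) (hβtop : ∀ y, β y ≠ ⊤)
    (hftop : ∀ z, f z ≠ ⊤) (hgtop : ∀ z, g z ≠ ⊤)
    (hf0 : ∀ x y, α x ≠ 0 → β y ≠ 0 → f (x, y) ≠ 0)
    (hg0 : ∀ x y, α x ≠ 0 → β y ≠ 0 → g (x, y) ≠ 0)
    (h : ∀ x y, α x ≠ 0 → β y ≠ 0 →
      ((α x).toReal / (f (x, y)).toReal) ^ r + ((β y).toReal / (g (x, y)).toReal) ^ r ≤ 1) :
    s ^ r + t ^ r ≤ 1 := by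
  set A := ∫⁻ x, α x ∂m₁
  set B := ∫⁻ y, β y ∂m₂
  have hp : 0 ≤ s ^ r := Real.rpow_nonneg hs.le r
  have hq : 0 ≤ t ^ r := Real.rpow_nonneg ht.le r
  have hpt : ∀ x y, ENNReal.ofReal ((1 + r) * (s ^ r + t ^ r)) * (α x * β y) ≤
      α x * β y + (ENNReal.ofReal (r * s ^ r) * (ENNReal.ofReal s * (f (x, y) * β y)) +
        ENNReal.ofReal (r * t ^ r) * (ENNReal.ofReal t * (α x * g (x, y)))) := by
    intro x y
    by_cases hx : α x = 0
    · simp [hx]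
    by_cases hy : β y = 0
    · simp [hy]
    have h1 := h x y hx hy
    have pα := ENNReal.toReal_pos hx (hαtop x)
    have pβ := ENNReal.toReal_pos hy (hβtop y)
    have pf := ENNReal.toReal_pos (hf0 x y hx hy) (hftop (x, y))
    have pg := ENNReal.toReal_pos (hg0 x y hx hy) (hgtop (x, y))
    rw [← ENNReal.ofReal_toReal (hαtop x), ← ENNReal.ofReal_toReal (hβtop y),
      ← ENNReal.ofReal_toReal (hftop (x, y)), ← ENNReal.ofReal_toReal (hgtop (x, y))]
    generalize (α x).toReal = a at *
    generalize (β y).toReal = b at *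
    generalize (f (x, y)).toReal = u at *
    generalize (g (x, y)).toReal = v at *
    have h2 := Real.rpow_mul_one_add_le hr hs (div_pos pα pf)
    have h3 := Real.rpow_mul_one_add_le hr ht (div_pos pβ pg)
    simp only [← ENNReal.ofReal_mul pα.le, ← ENNReal.ofReal_mul pf.le, ← ENNReal.ofReal_mul hs.le,
      ← ENNReal.ofReal_mul ht.le, ← ENNReal.ofReal_mul (mul_nonneg hr hp),
      ← ENNReal.ofReal_mul (mul_nonneg hr hq),
      ← ENNReal.ofReal_mul (mul_nonneg (add_nonneg zero_le_one hr) (add_nonneg hp hq))]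
    rw [← ENNReal.ofReal_add (by positivity) (by positivity),
      ← ENNReal.ofReal_add (by positivity) (by positivity)]
    refine ENNReal.ofReal_le_ofReal ?_
    -- Tangent lines at `s` and `t` are added to the pointwise hypothesis; multiplying by `a * b`
    -- then clears the denominators, leaving terms linear in `u` and `v`.
    have h4 : (1 + r) * (s ^ r + t ^ r) ≤
        1 + r * s ^ r * (s / (a / u)) + r * t ^ r * (t / (b / v)) := by linarith
    have h5 := mul_le_mul_of_nonneg_right h4 (mul_nonneg pα.le pβ.le)
    refine h5.trans_eq ?_
    field_simp
    ring
  have hint : ENNReal.ofReal ((1 + r) * (s ^ r + t ^ r)) * (A * B) ≤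
      A * B + (ENNReal.ofReal (r * s ^ r) * (A * B) + ENNReal.ofReal (r * t ^ r) * (A * B)) := by
    have hAB : ∫⁻ z : S × T, α z.1 * β z.2 ∂(m₁.prod m₂) = A * B :=
      lintegral_prod_mul hα.aemeasurable hβ.aemeasurable
    have hF : ∫⁻ z : S × T, ENNReal.ofReal s * (f z * β z.2) ∂(m₁.prod m₂) ≤ A * B := by
      rw [lintegral_prod_symm _ (by fun_prop), ← lintegral_const_mul _ hβ]
      refine lintegral_mono fun y ↦ ?_
      simp only [← mul_assoc]
      rw [lintegral_mul_const _ (by fun_prop), lintegral_const_mul _ (by fun_prop)]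
      gcongr
      exact hfs y
    have hG : ∫⁻ z : S × T, ENNReal.ofReal t * (α z.1 * g z) ∂(m₁.prod m₂) ≤ A * B := by
      rw [lintegral_prod _ (by fun_prop), ← lintegral_mul_const _ hα]
      refine lintegral_mono fun x ↦ ?_
      simp only [mul_left_comm (ENNReal.ofReal t)]
      rw [lintegral_const_mul _ (by fun_prop), lintegral_const_mul _ (by fun_prop)]
      gcongr
      exact hgt x
    calc _ = ∫⁻ z : S × T, ENNReal.ofReal ((1 + r) * (s ^ r + t ^ r)) * (α z.1 * β z.2)
          ∂(m₁.prod m₂) := by rw [lintegral_const_mul _ (by fun_prop), hAB]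
      _ ≤ _ := lintegral_mono fun z ↦ hpt z.1 z.2
      _ = _ := by
        rw [lintegral_add_left (by fun_prop), lintegral_add_left (by fun_prop),
          lintegral_const_mul (ENNReal.ofReal (r * s ^ r)) (by fun_prop),
          lintegral_const_mul (ENNReal.ofReal (r * t ^ r)) (by fun_prop), hAB]
      _ ≤ _ := add_le_add le_rfl (add_le_add (mul_le_mul' le_rfl hF) (mul_le_mul' le_rfl hG))
  have hAB0 : 0 < (A * B).toReal := ENNReal.toReal_pos (mul_ne_zero hα0 hβ0)
    (ENNReal.mul_ne_top hα1 hβ1)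
  rw [← ENNReal.ofReal_toReal (ENNReal.mul_ne_top hα1 hβ1),
    ← ENNReal.ofReal_mul (by positivity), ← ENNReal.ofReal_mul (by positivity),
    ← ENNReal.ofReal_mul (by positivity), ← ENNReal.ofReal_add (by positivity) (by positivity),
    ← ENNReal.ofReal_add (by positivity) (by positivity),
    ENNReal.ofReal_le_ofReal_iff (by positivity)] at hint
  nlinarith

/-! ### Monotonicity, `bmNorm` and inversion of Haar measures -/

lemma MeasureTheory.measure_le_measure_mul_right {L : Type*} [Group L] [MeasurableSpace L]
    [MeasurableMul L] (ν : Measure L) [ν.IsMulRightInvariant] (X : Set L) {Y : Set L}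
    (hY : Y.Nonempty) : ν X ≤ ν (X * Y) := by
  obtain ⟨y, hy⟩ := hY
  rw [← measure_preimage_mul_right ν y⁻¹ X]
  exact measure_mono fun x hx ↦ ⟨x * y⁻¹, hx, y, hy, by simp⟩

lemma MeasureTheory.measure_le_measure_mul_left {L : Type*} [Group L] [MeasurableSpace L]
    [MeasurableMul L] (μ : Measure L) [μ.IsMulLeftInvariant] {X : Set L} (Y : Set L)
    (hX : X.Nonempty) : μ Y ≤ μ (X * Y) := by
  obtain ⟨x, hx⟩ := hX
  rw [← measure_preimage_mul μ x⁻¹ Y]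
  exact measure_mono fun y hy ↦ ⟨x, hx, x⁻¹ * y, hy, by simp⟩

lemma IsSigmaCompact.measurableSet {X : Type*} [TopologicalSpace X] [T2Space X]
    [MeasurableSpace X] [BorelSpace X] {s : Set X} (hs : IsSigmaCompact s) : MeasurableSet s := by
  obtain ⟨C, hC, rfl⟩ := hs
  exact .iUnion fun i ↦ (hC i).measurableSet

lemma bmNorm_zero_left {n : ℕ} (hn : n ≠ 0) {y : ℝ} (hy : 0 ≤ y) : bmNorm n 0 y = y := by
  have hn' : (n : ℝ) ≠ 0 := Nat.cast_ne_zero.2 hn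
  rw [bmNorm, if_neg hn, abs_zero, Real.zero_rpow (by positivity), zero_add, one_div,
    Real.rpow_inv_natCast_pow (abs_nonneg y) hn, abs_of_nonneg hy]

lemma bmNorm_zero_right {n : ℕ} (hn : n ≠ 0) {x : ℝ} (hx : 0 ≤ x) : bmNorm n x 0 = x := by
  have hn' : (n : ℝ) ≠ 0 := Nat.cast_ne_zero.2 hn
  rw [bmNorm, if_neg hn, abs_zero, Real.zero_rpow (by positivity), add_zero, one_div,
    Real.rpow_inv_natCast_pow (abs_nonneg x) hn, abs_of_nonneg hx]

lemma bmNorm_le_one_iff {n : ℕ} (hn : n ≠ 0) {x y : ℝ} (hx : 0 ≤ x) (hy : 0 ≤ y) :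
    bmNorm n x y ≤ 1 ↔ x ^ (1 / (n : ℝ)) + y ^ (1 / (n : ℝ)) ≤ 1 := by
  rw [bmNorm, if_neg hn, abs_of_nonneg hx, abs_of_nonneg hy,
    pow_le_one_iff_of_nonneg (by positivity) hn]

lemma IsRightHaar.isLeftHaar_inv {G : Type*} [Group G] [TopologicalSpace G] [IsTopologicalGroup G]
    [MeasurableSpace G] [BorelSpace G] {ν : Measure G} (hν : IsRightHaar ν) :
    IsLeftHaar ν.inv := by
  obtain ⟨_, _, _, _⟩ := hν
  exact ⟨{}, inferInstance⟩

lemma IsLeftHaar.isRightHaar_inv {G : Type*} [Group G] [TopologicalSpace G] [IsTopologicalGroup G]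
    [MeasurableSpace G] [BorelSpace G] {μ : Measure G} (hμ : IsLeftHaar μ) :
    IsRightHaar μ.inv := by
  obtain ⟨_, _⟩ := hμ
  exact ⟨inferInstance, inferInstance, inferInstance, inferInstance⟩

/-! ### Sections of compact sets and transfer from `H` to `G` -/

section

variable {G : Type*} [Group G] [TopologicalSpace G] [IsTopologicalGroup G] {K H : Subgroup G}

lemma isCompact_setOf_mul_mem (hH : IsClosed (H : Set G)) {X : Set G} (hX : IsCompact X) (g : G) :
    IsCompact {h : H | g * h ∈ X} :=
  ((Homeomorph.mulLeft g).isClosedEmbedding.comp hH.isClosedEmbedding_subtypeVal).isCompact_preimage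
    hX

lemma isCompact_setOf_mul_mem' (hH : IsClosed (H : Set G)) {X : Set G} (hX : IsCompact X) (g : G) :
    IsCompact {h : H | h * g ∈ X} :=
  ((Homeomorph.mulRight g).isClosedEmbedding.comp
    hH.isClosedEmbedding_subtypeVal).isCompact_preimage hX

variable [T2Space G] [SecondCountableTopology G] [MeasurableSpace G] [BorelSpace G]

/-- The set is a continuous image of a closed subset of a σ-compact space, hence σ-compact and
Borel. Fubini needs this joint measurability. -/
lemma measurableSet_setOf_mem_mul [LocallyCompactSpace K] [LocallyCompactSpace H] {X Y : Set G}
    (hX : IsClosed X) (hY : IsClosed Y) :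
    MeasurableSet {z : (K × K) × H |
      z.2 ∈ {h : H | (z.1.1 : G) * h ∈ X} * {h : H | (h : G) * (z.1.2 : G)⁻¹ ∈ Y}} := by
  let S : Set ((K × K) × (H × H)) := {q | (q.1.1 : G) * q.2.1 ∈ X ∧ (q.2.2 : G) * (q.1.2 : G)⁻¹ ∈ Y}
  have hS : IsClosed S :=
    (hX.preimage (f := fun q : (K × K) × (H × H) ↦ (q.1.1 : G) * q.2.1) (by fun_prop)).inter
      (hY.preimage (f := fun q : (K × K) × (H × H) ↦ (q.2.2 : G) * (q.1.2 : G)⁻¹) (by fun_prop))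
  have h := ((isSigmaCompact_univ.of_isClosed_subset hS (Set.subset_univ S)).image
    (f := fun q : (K × K) × (H × H) ↦ (q.1, q.2.1 * q.2.2)) (by fun_prop)).measurableSet
  convert h using 1
  ext ⟨k, h⟩
  constructor
  · rintro ⟨x, hx, y, hy, hxy⟩
    exact ⟨(k, x, y), ⟨hx, hy⟩, Prod.ext rfl hxy⟩
  · rintro ⟨⟨k', x, y⟩, ⟨hx, hy⟩, hxy⟩
    obtain ⟨rfl, rfl⟩ := Prod.mk.inj hxy
    exact ⟨x, hx, y, hy, rfl⟩

lemma ofReal_div_mul_le_of_mul_le {a b C A I : ℝ≥0∞} (ha : a ≠ ⊤) (ha0 : a ≠ 0) (hb : b ≠ ⊤)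
    (hb0 : b ≠ 0) (hA : a = C * A) (hI : C * I ≤ b) :
    ENNReal.ofReal (a.toReal / b.toReal) * I ≤ A := by
  have hC0 : C ≠ 0 := by rintro rfl; simp [hA] at ha0
  have hCt : C ≠ ⊤ := by
    rintro rfl
    refine ha ?_
    rw [hA, ENNReal.top_mul]
    rintro rfl
    simp [hA] at ha0
  rw [← ENNReal.toReal_div, ENNReal.ofReal_toReal (ENNReal.div_ne_top ha hb0)]
  rw [← ENNReal.mul_le_mul_iff_right hC0 hCt, ← hA, mul_left_comm]
  calc a / b * (C * I) ≤ a / b * b := by gcongr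
    _ = a := ENNReal.div_mul_cancel hb0 hb

/-- The Brunn-Minkowski inequality passes from `H` to a unimodular group `G = KH`. -/
theorem satisfiesBM_of_mul_eq_univ [LocallyCompactSpace G] (hG : IsUnimodular G) (n : ℕ)
    (hH : IsClosed (H : Set G)) (hHBM : SatisfiesBM n H)
    (hK : IsClosed (K : Set G)) (hKuni : IsUnimodular K)
    (hKH : (K : Set G) * (H : Set G) = Set.univ)
    (hc : IsCompact ((K : Set G) ∩ (H : Set G))) :
    SatisfiesBM n G := by
  intro μ ν hμ hν X Y hX hY hXne hYne
  have := hμ.isHaar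
  have := hG μ hμ
  have := hν.rightInvariant
  have := hν.finiteOnCompacts
  have := hν.openPos
  have : ν.IsMulLeftInvariant := by
    have := hG _ hν.isLeftHaar_inv
    rw [← ν.inv_inv]
    infer_instance
  have hXY : IsCompact (X * Y) := hX.mul hY
  have hνXY : ν X ≤ ν (X * Y) := measure_le_measure_mul_right ν X hYne
  have hμXY : μ Y ≤ μ (X * Y) := measure_le_measure_mul_left μ Y hXne
  have hx1 : ν.real X / ν.real (X * Y) ≤ 1 :=
    div_le_one_of_le₀ (ENNReal.toReal_mono hXY.measure_lt_top.ne hνXY) measureReal_nonneg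
  have hy1 : μ.real Y / μ.real (X * Y) ≤ 1 :=
    div_le_one_of_le₀ (ENNReal.toReal_mono hXY.measure_lt_top.ne hμXY) measureReal_nonneg
  have hx0 : 0 ≤ ν.real X / ν.real (X * Y) := by positivity
  have hy0 : 0 ≤ μ.real Y / μ.real (X * Y) := by positivity
  rcases eq_or_ne n 0 with rfl | hn
  · rw [bmNorm, if_pos rfl, abs_of_nonneg hx0, abs_of_nonneg hy0]
    exact max_le hx1 hy1
  -- If one set is null, the norm is the other ratio, which is at most `1`.
  by_cases hX0 : ν X = 0
  · simpa [measureReal_def, hX0] using (bmNorm_zero_left hn hy0).trans_le hy1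
  by_cases hY0 : μ Y = 0
  · simpa [measureReal_def, hY0] using (bmNorm_zero_right hn hx0).trans_le hx1
  have hνXY0 : ν (X * Y) ≠ 0 := fun h ↦ hX0 (le_antisymm (h ▸ hνXY) bot_le)
  have hμXY0 : μ (X * Y) ≠ 0 := fun h ↦ hY0 (le_antisymm (h ▸ hμXY) bot_le)
  have hXt := hX.measure_lt_top (μ := ν) |>.ne
  have hYt := hY.measure_lt_top (μ := μ) |>.ne
  have : LocallyCompactSpace K := hK.isClosedEmbedding_subtypeVal.locallyCompactSpace
  have : LocallyCompactSpace H := hH.isClosedEmbedding_subtypeVal.locallyCompactSpace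
  let μK : Measure K := Measure.haar
  let μH : Measure H := Measure.haar
  have : μK.IsMulRightInvariant := hKuni μK ⟨inferInstance, inferInstance⟩
  have hμH : IsLeftHaar μH := ⟨inferInstance, inferInstance⟩
  have hsec (m : Measure H) [SFinite m] (B : Set G) (hB : MeasurableSet B) :
      (μK.prod m) {p | (p.1 : G) * p.2 ∈ B} = ∫⁻ k : K, m {h | (k : G) * h ∈ B} ∂μK :=
    Measure.prod_apply (hB.preimage (f := fun p : K × H ↦ (p.1 : G) * p.2) (by fun_prop))
  obtain ⟨C, hC⟩ : ∃ C : ℝ≥0∞, ∀ B : Set G, MeasurableSet B →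
      ν B = C * ∫⁻ k : K, μH.inv {h | (k : G) * h ∈ B} ∂μK := by
    obtain ⟨C, hC⟩ := exists_measure_eq_mul_prod_setOf_mul_mem hK hH hc hKH μK μH ν
      (fun k _ ↦ measurePreserving_mul_left ν k) (fun h _ ↦ measurePreserving_mul_right ν h)
    exact ⟨C, fun B hB ↦ by rw [hC B hB, hsec _ _ hB]⟩
  obtain ⟨C', hC'⟩ : ∃ C : ℝ≥0∞, ∀ B : Set G, MeasurableSet B →
      μ B = C * ∫⁻ k : K, μH {h | (h : G) * (k : G)⁻¹ ∈ B} ∂μK := by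
    -- Inversion turns the formula for `μ.inv` and `B⁻¹` into one with `k⁻¹` on the right.
    obtain ⟨C, hC⟩ := exists_measure_eq_mul_prod_setOf_mul_mem hK hH hc hKH μK μH μ.inv
      (fun k _ ↦ measurePreserving_mul_left μ.inv k) (fun h _ ↦ measurePreserving_mul_right μ.inv h)
    refine ⟨C, fun B hB ↦ ?_⟩
    have h := hC B⁻¹ hB.inv
    rw [Measure.inv_apply, inv_inv, hsec _ _ hB.inv] at h
    rw [h]
    congr 1
    refine lintegral_congr fun k ↦ ?_
    rw [Measure.inv_apply]
    congr 1
    ext h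
    simp
  let XK : K → Set H := fun k ↦ {h | (k : G) * h ∈ X}
  let YK : K → Set H := fun k ↦ {h | (h : G) * (k : G)⁻¹ ∈ Y}
  have hXK : ∀ k, IsCompact (XK k) := fun k ↦ isCompact_setOf_mul_mem hH hX _
  have hYK : ∀ k, IsCompact (YK k) := fun k ↦ isCompact_setOf_mul_mem' hH hY _
  have hmeas := measurableSet_setOf_mem_mul (K := K) (H := H) hX.isClosed hY.isClosed
  have hfin (m : Measure H) [IsFiniteMeasureOnCompacts m] (k k' : K) : m (XK k * YK k') ≠ ⊤ :=
    ((hXK k).mul (hYK k')).measure_lt_top.ne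
  have hne (m : Measure H) {S : Set H} (hS : m S ≠ 0) : S.Nonempty := nonempty_of_measure_ne_zero hS
  have hA := hC X hX.measurableSet
  have hB := hC' Y hY.measurableSet
  have hf (k' : K) : C * ∫⁻ k, μH.inv (XK k * YK k') ∂μK ≤ ν (X * Y) := by
    -- `X_k Y_k'` lies in the `k`-section of `XYk'`, which has the same measure as `XY`.
    rw [← measure_preimage_mul_right ν (k' : G)⁻¹,
      hC _ (hXY.measurableSet.preimage (measurable_mul_const _))]
    gcongr with k
    rintro _ ⟨x, hx, y, hy, rfl⟩
    exact ⟨_, hx, _, hy, by simp [mul_assoc]⟩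
  have hg (k : K) : C' * ∫⁻ k', μH (XK k * YK k') ∂μK ≤ μ (X * Y) := by
    rw [← measure_preimage_mul μ (k : G), hC' _ (hXY.measurableSet.preimage (measurable_const_mul _))]
    gcongr with k'
    rintro _ ⟨x, hx, y, hy, rfl⟩
    exact ⟨_, hx, _, hy, by simp [mul_assoc]⟩
  have htop {a b c : ℝ≥0∞} (h : a = c * b) (ha : a ≠ ⊤) (ha0 : a ≠ 0) : b ≠ ⊤ := by
    rintro rfl
    refine ha (h.trans (ENNReal.mul_top ?_))
    rintro rfl
    simp [h] at ha0
  rw [bmNorm_le_one_iff hn hx0 hy0]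
  refine rpow_add_rpow_le_one_of_forall μK μK (α := fun k ↦ μH.inv (XK k)) (β := fun k ↦ μH (YK k))
    (f := fun z ↦ μH.inv (XK z.1 * YK z.2)) (g := fun z ↦ μH (XK z.1 * YK z.2))
    (measurable_measure_prodMk_left (hX.measurableSet.preimage
      (f := fun p : K × H ↦ (p.1 : G) * p.2) (by fun_prop)))
    (measurable_measure_prodMk_left (hY.measurableSet.preimage
      (f := fun p : K × H ↦ (p.2 : G) * (p.1 : G)⁻¹) (by fun_prop)))
    (measurable_measure_prodMk_left hmeas) (measurable_measure_prodMk_left hmeas)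
    (fun h ↦ hX0 (by rw [hA, h, mul_zero])) (htop hA hXt hX0)
    (fun h ↦ hY0 (by rw [hB, h, mul_zero])) (htop hB hYt hY0)
    (by positivity)
    (div_pos (ENNReal.toReal_pos hX0 hXt) (ENNReal.toReal_pos hνXY0 hXY.measure_lt_top.ne))
    (div_pos (ENNReal.toReal_pos hY0 hYt) (ENNReal.toReal_pos hμXY0 hXY.measure_lt_top.ne))
    (fun k' ↦ ofReal_div_mul_le_of_mul_le hXt hX0 hXY.measure_lt_top.ne hνXY0 hA (hf k'))
    (fun k ↦ ofReal_div_mul_le_of_mul_le hYt hY0 hXY.measure_lt_top.ne hμXY0 hB (hg k))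
    (fun k ↦ (hXK k).measure_lt_top.ne) (fun k ↦ (hYK k).measure_lt_top.ne)
    (fun z ↦ hfin _ z.1 z.2) (fun z ↦ hfin _ z.1 z.2)
    (fun k k' h h' h0 ↦ h (le_antisymm
      (h0 ▸ measure_le_measure_mul_right μH.inv (XK k) (hne _ h')) bot_le))
    (fun k k' h h' h0 ↦ h' (le_antisymm
      (h0 ▸ measure_le_measure_mul_left μH (YK k') (hne _ h)) bot_le))
    (fun k k' h h' ↦ ?_)
  exact (bmNorm_le_one_iff hn (by positivity) (by positivity)).1
    (hHBM μH μH.inv hμH hμH.isRightHaar_inv (XK k) (YK k') (hXK k) (hYK k') (hne _ h) (hne _ h'))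

end

end

theorem mainTheorem7
    {E : Type*} [NormedAddCommGroup E] [NormedSpace ℝ E] [FiniteDimensional ℝ E]
    {G : Type*} [Group G] [TopologicalSpace G] [T2Space G] [SecondCountableTopology G]
    [ChartedSpace E G] [LieGroup 𝓘(ℝ, E) ∞ G] [ConnectedSpace G]
    [MeasurableSpace G] [BorelSpace G]
    (hG : IsUnimodular G)
    (n : ℕ)
    (H : Subgroup G) (hHclosed : IsClosed (H : Set G)) (hHconn : IsConnected (H : Set G))
    (hHBM : SatisfiesBM n H)
    (K : Subgroup G) (hKclosed : IsClosed (K : Set G)) (hKconn : IsConnected (K : Set G))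
    (hKuni : IsUnimodular K)
    (hKH : (K : Set G) * (H : Set G) = Set.univ)
    (hcompact : IsCompact ((K : Set G) ∩ (H : Set G))) :
    SatisfiesBM n G := by
  have : IsTopologicalGroup G := topologicalGroup_of_lieGroup 𝓘(ℝ, E) ∞
  have : LocallyCompactSpace G := Manifold.locallyCompact_of_finiteDimensional 𝓘(ℝ, E)
  exact satisfiesBM_of_mul_eq_univ hG n hHclosed hHBM hKclosed hKuni hKH hcompact
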